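/- Convergence of the parameters in the RQMC-based MAMIS algorithm. Setting. Let $\mathcal X\subseteq\mathbb R^s$ be measurable, $\pi$ a probability density on $\mathcal X$ (target distribution $\Pi$), $\Theta\subseteq\mathbb R^D$, and for $\theta\in\Theta$ let $Q(\theta)$ be a probability distribution with density $q(\cdot,\theta)$ on $\mathcal X$ such that $\Pi\ll Q(\theta)$. Let $F_\theta:\mathbb R^d\to\mathbb R^s$ ($d\ge 1$) satisfy $F_\theta(U)\sim Q(\theta)$ for $U\sim\mathcal U[0,1)^d$, let $\Phi$ be the standard normal distribution function acting componentwise, and $T_\theta=F_\theta\circ\Phi$. Let $h=(h_1,\dots,h_D):\mathbb R^s\to\mathbb R^D$ and $\theta^*=\int_{\mathcal X}h(x)\pi(x)\,dx$ (all functions are measurable, $F$ and $q$ jointly in both arguments). Given a deterministic $\hat\theta_1\in\Theta$ and sample sizes $N_1,\dots,N_T$, put $$X_i^t=F_{\hat\theta_t}(u_i^t),\qquad \hat\theta_{t+1}=\frac1{N_t}\sum_{i=1}^{N_t}\frac{\pi(X_i^t)}{q(X_i^t,\hat\theta_t)}\,h(X_i^t),\qquad 1\le t\le T,$$ where $\hat\theta_t\in\Theta$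 almost surely for all $t\le T$, and where for each $t$ the random points $u_1^t,\dots,u_{N_t}^t$ are jointly independent of $\hat\theta_t$, each $u_i^t\sim\mathcal U[0,1)^d$, and the star discrepancy satisfies $D^*_{N_t}(\{u_1^t,\dots,u_{N_t}^t\})\le C(\log N_t)^{d-1}/N_t$ almost surely, with a constant $C$ independent of $N_t$ and $t$. For $M,B,k>0$ let $G_e(M,B,k)$ be the set of all $f:\mathbb R^d\to\mathbb R$ whose mixed partial derivatives $\partial^uf$ (at most once in each variable) exist and are continuous for all $u\subseteq\{1,\dots,d\}$ and satisfy $|\partial^uf(x)|\le B e^{M|x|^k}$ for all $x\in\mathbb R^d$. Theorem. Let $q\ge2$, $0<k<2$, $M,B>0$, and assume $$\frac{\pi h_j}{q(\cdot,\theta)}\circ T_\theta\in G_e(M,B,k)\qquad\text{for all }\theta\in\Theta,\ j=1,\dots,D.$$ Then, for every $t\le T$ with $N_t\ge2$ and every $j$, $$\bigl(\mathbb E|\hat\theta_{t+1,j}-\theta^*_j|^q\bigr)^{1/q}\le K\,N_t^{-1}(\log N_t)^{\frac{3d}2-1}\exp\{M(4qd\log N_t)^{k/2}\},$$ where $K$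 depends only on $M,B,k,d,q$ and the discrepancy constant $C$, and $$\bigl(\mathbb E\|\hat\theta_{t+1}-\theta^*\|^q\bigr)^{1/q}\le K'\,N_t^{-1}(\log N_t)^{\frac{3d}2-1}\exp\{M(4qd\log N_t)^{k/2}\}$$ with the Euclidean norm, where $K'$ depends only on $M,B,k,d,D,q$ and $C$. -/

import Mathlib

open MeasureTheory ProbabilityTheory

noncomputable section

/-- Euclidean space `ℝ^n` (with the Euclidean norm and Lebesgue measure). -/
abbrev RSp (n : ℕ) : Type := EuclideanSpace ℝ (Fin n)

/-- `g u` is the mixed partial derivative `∂^u f` for every `u ⊆ {1, …, d}`, and all of them are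
continuous. Each `g (insert i u)`, `i ∉ u`, is the everywhere existing partial derivative of `g u`
in the coordinate direction `i`; so `g` is determined by `f`, and its existence says that
`f ∈ 𝒮^d(ℝ^d)`. -/
def IsMixedPartials {d : ℕ} (f : RSp d → ℝ) (g : Finset (Fin d) → RSp d → ℝ) : Prop :=
  g ∅ = f ∧
  (∀ u, Continuous (g u)) ∧
  ∀ (u : Finset (Fin d)) (i : Fin d), i ∉ u →
    ∀ x : RSp d, HasLineDerivAt ℝ (g u) (g (insert i u) x) x (EuclideanSpace.single i 1)

/-- The growth class `G_e(M, B, k)`: all mixed partial derivatives `∂^u f`, `u ⊆ {1, …, d}`,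
exist, are continuous, and satisfy `|∂^u f (x)| ≤ B exp (M |x|^k)` on `ℝ^d`. -/
def GrowthClass (d : ℕ) (M B k : ℝ) : Set (RSp d → ℝ) :=
  {f | ∃ g : Finset (Fin d) → RSp d → ℝ, IsMixedPartials f g ∧
    ∀ (u : Finset (Fin d)) (x : RSp d), |g u x| ≤ B * Real.exp (M * ‖x‖ ^ k)}

/-- The half-open unit cube `[0,1)^d`. -/
def unitCube (d : ℕ) : Set (RSp d) := {y | ∀ j, 0 ≤ y j ∧ y j < 1}

/-- The uniform distribution on `[0,1)^d`. -/
def uniformCube (d : ℕ) : Measure (RSp d) := volume.restrict (unitCube d)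

/-- The standard normal distribution function `Φ`, applied to every coordinate. -/
def stdNormalCDF {d : ℕ} (x : RSp d) : RSp d :=
  WithLp.toLp 2 fun j => cdf (gaussianReal 0 1) (x j)

open Classical in
/-- The star discrepancy of the points `y_1, …, y_n` of `[0,1)^d`: the supremum over the anchored
boxes `[0,a)`, `a ∈ [0,1]^d`, of `|#{i : y_i ∈ [0,a)} / n - vol [0,a)|`. -/
def starDiscrepancy {n d : ℕ} (y : Fin n → RSp d) : ℝ :=
  ⨆ a : {a : Fin d → ℝ // ∀ j, 0 ≤ a j ∧ a j ≤ 1},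
    |((Finset.univ.filter fun i => ∀ j, 0 ≤ y i j ∧ y i j < a.1 j).card : ℝ) / n - ∏ j, a.1 j|

/-- The requirements on an RQMC point set: random points, each of them uniformly distributed on
`[0,1)^d`, with star discrepancy at most `C (log n)^{d-1} / n` almost surely. -/
structure IsRQMC {Ω : Type*} [MeasurableSpace Ω] (P : Measure Ω) {n d : ℕ} (C : ℝ)
    (y : Fin n → Ω → RSp d) : Prop where
  measurable : ∀ i, Measurable (y i)
  uniform : ∀ i, P.map (y i) = uniformCube d
  discrepancy : ∀ᵐ ω ∂P, starDiscrepancy (fun i => y i ω) ≤ C * Real.log n ^ (d - 1) / n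

/-- The input of the RQMC-based MAMIS algorithm. Stages are numbered from `1` to `T`; values at
other stages, and at parameters outside `Θ`, play no role. -/
structure MAMIS (d s D : ℕ) (Ω : Type*) where
  /-- the domain `𝒳 ⊆ ℝ^s` -/
  X : Set (RSp s)
  /-- the target density `π` -/
  target : RSp s → ℝ
  /-- the parameter set `Θ ⊆ ℝ^D` -/
  Θ : Set (RSp D)
  /-- the proposal densities `q(x, θ)` -/
  q : RSp s → RSp D → ℝ
  /-- the function `h` with `θ* = ∫ h π` -/
  h : RSp s → RSp D
  /-- the generators `F_θ` of the proposals `Q(θ)` -/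
  F : RSp D → RSp d → RSp s
  /-- the initial parameter -/
  θinit : RSp D
  /-- the number of stages -/
  T : ℕ
  /-- the sample sizes -/
  N : ℕ → ℕ
  /-- the points `u_i^t` -/
  u : (t : ℕ) → Fin (N t) → Ω → RSp d

namespace MAMIS

variable {d s D : ℕ} {Ω : Type*} (A : MAMIS d s D Ω)

/-- The target distribution `Π`, with density `π` on `𝒳`. -/
def targetMeasure : Measure (RSp s) :=
  (volume.restrict A.X).withDensity fun x => ENNReal.ofReal (A.target x)

/-- The proposal distribution `Q(θ)`, with density `q(·, θ)` on `𝒳`. -/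
def proposal (θ : RSp D) : Measure (RSp s) :=
  (volume.restrict A.X).withDensity fun x => ENNReal.ofReal (A.q x θ)

/-- `θ* = ∫_𝒳 h(x) π(x) dx`. -/
def thetaStar : RSp D := ∫ x in A.X, A.target x • A.h x

/-- The weighted integrand `h_θ = π h / q(·, θ)`. -/
def weighted (θ : RSp D) (x : RSp s) : RSp D := (A.target x / A.q x θ) • A.h x

/-- The transport map `T_θ = F_θ ∘ Φ`. -/
def transport (θ : RSp D) : RSp d → RSp s := A.F θ ∘ stdNormalCDF

/-- The parameters of the algorithm: `θ̂_1` is the initial parameter and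
`θ̂_{t+1} = N_t⁻¹ ∑ i, π(X_i^t) / q(X_i^t, θ̂_t) h(X_i^t)` with `X_i^t = F_{θ̂_t}(u_i^t)`.
(The index `0` is not used.) -/
def thetaHat : ℕ → Ω → RSp D
  | 0 => fun _ => A.θinit
  | 1 => fun _ => A.θinit
  | t + 2 => fun ω =>
      (A.N (t + 1) : ℝ)⁻¹ • ∑ i : Fin (A.N (t + 1)),
        A.weighted (thetaHat (t + 1) ω) (A.F (thetaHat (t + 1) ω) (A.u (t + 1) i ω))

/-- The standing assumptions of the RQMC-based MAMIS algorithm: `Π` is a probability distribution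
with density `π`; `F_θ(U) ∼ Q(θ)` for `U` uniform on the cube; the weight `dΠ/dQ(θ)` exists; the
parameters stay in `Θ`; in each stage the points are an RQMC point set which is independent of the
current parameter. -/
structure Standing [MeasurableSpace Ω] (P : Measure Ω) (C : ℝ) : Prop where
  measurableSet_X : MeasurableSet A.X
  measurable_target : Measurable A.target
  measurable_q : Measurable fun p : RSp s × RSp D => A.q p.1 p.2
  measurable_h : Measurable A.h
  measurable_F : Measurable fun p : RSp D × RSp d => A.F p.1 p.2
  target_nonneg : ∀ x ∈ A.X, 0 ≤ A.target x
  target_prob : IsProbabilityMeasure A.targetMeasure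
  q_nonneg : ∀ θ ∈ A.Θ, ∀ x ∈ A.X, 0 ≤ A.q x θ
  generator : ∀ θ ∈ A.Θ, (uniformCube d).map (A.F θ) = A.proposal θ
  dominated : ∀ θ ∈ A.Θ, A.targetMeasure ≪ A.proposal θ
  mem_Θ : ∀ t ∈ Finset.Icc 1 A.T, ∀ᵐ ω ∂P, A.thetaHat t ω ∈ A.Θ
  rqmc : ∀ t ∈ Finset.Icc 1 A.T, IsRQMC P C (A.u t)
  indep : ∀ t ∈ Finset.Icc 1 A.T, IndepFun (fun ω i => A.u t i ω) (A.thetaHat t) P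

/-- The growth condition: `(π h_j / q(·, θ)) ∘ T_θ ∈ G_e(M, B, k)` for all `θ ∈ Θ` and `j`. -/
def Growth (M B k : ℝ) : Prop :=
  ∀ θ ∈ A.Θ, ∀ j : Fin D,
    ((fun x => A.target x * A.h x j / A.q x θ) ∘ A.transport θ) ∈ GrowthClass d M B k

end MAMIS

/-- The rate `n⁻¹ (log n)^{3d/2 - 1} exp (M (4 q d log n)^{k/2})`. -/
def thetaRate (d : ℕ) (M k q : ℝ) (n : ℕ) : ℝ :=
  (n : ℝ)⁻¹ * Real.log n ^ (3 * (d : ℝ) / 2 - 1) *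
    Real.exp (M * (4 * q * d * Real.log n) ^ (k / 2))

end

/-! For fixed `θ ∈ Θ` the estimator averages `G = (π h_j / q(·, θ)) ∘ F_θ` over the points. Since
`F_θ` pushes the uniform law to `Q(θ)` and `Π ≪ Q(θ)`, the mean of `G` is `θ*_j` for every `θ ∈ Θ`.
What remains is a quadrature error, with constants uniform in `θ`, for a `G` that may blow up at the
boundary of the cube but whose pullback `G ∘ Φ` lies in the growth class.

Project the Gaussian argument onto `[-R, R]^d` with `R = 2 √(q log n)`. For the projected integrand
a Koksma–Hlawka inequality (`abs_integral_clampBox_sub_le`) bounds the error by `(1 + 2R)^d`, times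
the supremum of the mixed partials on the box, times the discrepancy. These are of order `(log
n)^{d/2}`, `exp (M (d R^2)^{k/2})` and `(log n)^{d-1} / n`, and their product is the rate. The bound
holds pathwise and for all `θ ∈ Θ` at once, so a random parameter does no harm.

The remainder vanishes on the box. By Hölder its `L^q` norm is at most a finite Gaussian moment (`k
< 2`) times the `2q`-th root of the tail probability, and `R` is chosen to make that root of order
`1/n` (`exists_eLpNorm_sub_clampBox_le`). For the random parameter, independence allows conditioning
on `θ̂_t`, each point is uniform, and Minkowski's inequality handles the average; no independence
between points is needed (`exists_eLpNorm_average_sub_le`). -/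

/-! ### Coordinatewise projections and orthants -/

/-- The projection of `ℝ` onto the interval `[-R, R]`. -/
noncomputable def clamp (R a : ℝ) : ℝ := max (-R) (min a R)

/-- The projection of `ℝ^d` onto the cube `[-R, R]^d`. -/
noncomputable def clampBox {d : ℕ} (R : ℝ) (x : RSp d) : RSp d :=
  WithLp.toLp 2 fun j => clamp R (x j)

/-- The point with coordinates `clamp R (x j)` for `j ∈ s` and `y j` for `j ∉ s`. -/
noncomputable def mixClamp {d : ℕ} (R : ℝ) (s : Finset (Fin d)) (x y : RSp d) : RSp d :=
  WithLp.toLp 2 fun j => if j ∈ s then clamp R (x j) else y j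

/-- Replace the `i`-th coordinate of `y` by `t`. -/
noncomputable def updateCoord {d : ℕ} (y : RSp d) (i : Fin d) (t : ℝ) : RSp d :=
  WithLp.toLp 2 (Function.update y i t)

/-- The open orthant `{x | x_j < y_j for all j ∈ v}`. -/
def lowerOrthant {d : ℕ} (v : Finset (Fin d)) (y : RSp d) : Set (RSp d) :=
  {x | ∀ j ∈ v, x j < y j}

lemma continuous_clamp (R : ℝ) : Continuous (clamp R) := by
  unfold clamp; fun_prop

lemma abs_clamp_le {R : ℝ} (hR : 0 ≤ R) (a : ℝ) : |clamp R a| ≤ R :=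
  abs_le.2 ⟨le_max_left _ _, max_le (by linarith) (min_le_right _ _)⟩

lemma clamp_of_abs_le {R a : ℝ} (h : |a| ≤ R) : clamp R a = a := by
  rw [clamp, min_eq_left (abs_le.1 h).2, max_eq_right (abs_le.1 h).1]

lemma abs_clamp_le_abs {R : ℝ} (hR : 0 ≤ R) (a : ℝ) : |clamp R a| ≤ |a| := by
  by_cases h : |a| ≤ R
  · rw [clamp_of_abs_le h]
  · exact (abs_clamp_le hR a).trans (not_le.1 h).le

@[simp] lemma clampBox_apply {d : ℕ} (R : ℝ) (x : RSp d) (j : Fin d) :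
    clampBox R x j = clamp R (x j) := rfl

@[simp] lemma mixClamp_apply {d : ℕ} (R : ℝ) (s : Finset (Fin d)) (x y : RSp d) (j : Fin d) :
    mixClamp R s x y j = if j ∈ s then clamp R (x j) else y j := rfl

@[simp] lemma updateCoord_apply {d : ℕ} (y : RSp d) (i : Fin d) (t : ℝ) (j : Fin d) :
    updateCoord y i t j = if j = i then t else y j := by
  simp [updateCoord, Function.update_apply]

lemma continuous_mixClamp_updateCoord {d : ℕ} (R : ℝ) (s : Finset (Fin d)) (y : RSp d)
    (i : Fin d) :
    Continuous fun p : RSp d × ℝ => mixClamp R s p.1 (updateCoord y i p.2) := by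
  refine (PiLp.continuous_toLp 2 _).comp (continuous_pi fun j => ?_)
  have h := continuous_clamp R
  simp only [updateCoord_apply]
  split_ifs <;> fun_prop

lemma abs_mixClamp_le {d : ℕ} {R : ℝ} (hR : 0 ≤ R) (s : Finset (Fin d)) (x y : RSp d)
    (hy : ∀ j, |y j| ≤ R) (j : Fin d) : |mixClamp R s x y j| ≤ R := by
  rw [mixClamp_apply]
  split_ifs
  exacts [abs_clamp_le hR _, hy j]

lemma mixClamp_insert {d : ℕ} (R : ℝ) {s : Finset (Fin d)} {i : Fin d} (hi : i ∉ s)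
    (x y : RSp d) :
    mixClamp R (insert i s) x y = mixClamp R s x (updateCoord y i (clamp R (x i))) := by
  ext j
  by_cases hj : j = i
  · subst hj; simp [hi]
  · simp [hj]

/-- The points of `(-R, R]` above `a` form exactly `(clamp R a, R]`, also when `a` lies outside
`[-R, R]`, so this is the fundamental theorem of calculus. The dependence on `a` is now only through
an indicator, which integrates to the measure of a half-line. -/
lemma eval_clamp_eq {φ φ' : ℝ → ℝ} (h : ∀ t, HasDerivAt φ (φ' t) t) (hc : Continuous φ')
    {R : ℝ} (hR : 0 ≤ R) (a : ℝ) :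
    φ (clamp R a) = φ R - ∫ t in Set.Ioc (-R) R, (Set.Ioi a).indicator φ' t := by
  have h1 : ∫ t in (clamp R a)..R, φ' t = φ R - φ (clamp R a) :=
    intervalIntegral.integral_eq_sub_of_hasDerivAt (fun t _ => h t) (hc.intervalIntegrable _ _)
  have hle : clamp R a ≤ R := (abs_le.1 (abs_clamp_le hR a)).2
  rw [setIntegral_indicator measurableSet_Ioi]
  have h2 : Set.Ioc (-R) R ∩ Set.Ioi a = Set.Ioc (clamp R a) R := by
    ext t
    simp only [clamp, Set.mem_inter_iff, Set.mem_Ioc, Set.mem_Ioi, max_lt_iff, min_lt_iff]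
    constructor
    · rintro ⟨⟨h1, h2⟩, h3⟩; exact ⟨⟨h1, Or.inl h3⟩, h2⟩
    · rintro ⟨⟨h1, h2⟩, h3⟩; exact ⟨⟨h1, h3⟩, h2.resolve_right (not_lt.2 h3)⟩
  rw [h2, ← intervalIntegral.integral_of_le hle, h1]
  ring

lemma IsMixedPartials.hasDerivAt_mixClamp {d : ℕ} {f : RSp d → ℝ}
    {g : Finset (Fin d) → RSp d → ℝ} (hg : IsMixedPartials f g) (R : ℝ) {s v : Finset (Fin d)}
    {i : Fin d} (his : i ∉ s) (hiv : i ∉ v) (x y : RSp d) (t : ℝ) :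
    HasDerivAt (fun t => g v (mixClamp R s x (updateCoord y i t)))
      (g (insert i v) (mixClamp R s x (updateCoord y i t))) t := by
  have h := hg.2.2 v i hiv (mixClamp R s x (updateCoord y i t))
  unfold HasLineDerivAt at h
  have h2 : HasDerivAt (fun r => g v (mixClamp R s x (updateCoord y i t) +
      (r - t) • EuclideanSpace.single i (1 : ℝ)))
      (g (insert i v) (mixClamp R s x (updateCoord y i t))) t := by
    have h3 := HasDerivAt.comp_sub_const (𝕜 := ℝ) t t (by simpa using h)
    simpa using h3
  refine h2.congr_of_eventuallyEq (Filter.Eventually.of_forall fun r => ?_)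
  simp only
  congr 1
  ext j
  by_cases hj : j = i
  · subst hj; simp [his]
  · simp [hj]

lemma measurableSet_lowerOrthant {d : ℕ} (v : Finset (Fin d)) (y : RSp d) :
    MeasurableSet (lowerOrthant v y) := by
  have : lowerOrthant v y = ⋂ j ∈ v, {x : RSp d | x j < y j} := by ext; simp [lowerOrthant]
  rw [this]
  exact Finset.measurableSet_biInter v fun j _ => measurableSet_lt (by fun_prop) (by fun_prop)

lemma measurableSet_lowerOrthant_updateCoord {d : ℕ} (v : Finset (Fin d)) (y : RSp d)
    (i : Fin d) :
    MeasurableSet {p : RSp d × ℝ | p.1 ∈ lowerOrthant v (updateCoord y i p.2)} := by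
  have : {p : RSp d × ℝ | p.1 ∈ lowerOrthant v (updateCoord y i p.2)} =
      ⋂ j ∈ v, {p : RSp d × ℝ | p.1 j < if j = i then p.2 else y j} := by
    ext; simp [lowerOrthant]
  rw [this]
  refine Finset.measurableSet_biInter v fun j _ => ?_
  split_ifs
  · exact measurableSet_lt (by fun_prop) (by fun_prop)
  · exact measurableSet_lt (by fun_prop) (by fun_prop)

/-- The integral over an orthant of a mixed partial derivative, as a function of the point with
some coordinates clamped to `[-R, R]` and the others frozen. -/
noncomputable def orthantIntegral {d : ℕ} (g : Finset (Fin d) → RSp d → ℝ) (R : ℝ)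
    (μ : Measure (RSp d)) (s v : Finset (Fin d)) (y : RSp d) : ℝ :=
  ∫ x, (lowerOrthant v y).indicator (fun x => g v (mixClamp R s x y)) x ∂μ

lemma abs_updateCoord_le {d : ℕ} {R : ℝ} {y : RSp d} (hy : ∀ j, |y j| ≤ R) (i : Fin d) {t : ℝ}
    (ht : |t| ≤ R) (j : Fin d) : |updateCoord y i t j| ≤ R := by
  rw [updateCoord_apply]; split_ifs
  exacts [ht, hy j]

/-! ### Koksma–Hlawka inequality for projected functions -/

section KoksmaHlawka

variable {d : ℕ} {f : RSp d → ℝ} {g : Finset (Fin d) → RSp d → ℝ} {R b : ℝ}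

lemma integrable_orthant_prod (hg : IsMixedPartials f g) (hR : 0 ≤ R)
    (hb : ∀ u x, (∀ j, |x j| ≤ R) → |g u x| ≤ b) (μ : Measure (RSp d)) [IsFiniteMeasure μ]
    (s v : Finset (Fin d)) (i : Fin d) {y : RSp d} (hy : ∀ j, |y j| ≤ R) :
    Integrable (fun p : RSp d × ℝ => (lowerOrthant v (updateCoord y i p.2)).indicator
      (fun x => g v (mixClamp R s x (updateCoord y i p.2))) p.1)
      (μ.prod (volume.restrict (Set.Ioc (-R) R))) := by
  have hm : Measurable (fun p : RSp d × ℝ => (lowerOrthant v (updateCoord y i p.2)).indicator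
      (fun x => g v (mixClamp R s x (updateCoord y i p.2))) p.1) :=
    (((hg.2.1 v).comp (continuous_mixClamp_updateCoord R s y i)).measurable).indicator
      (measurableSet_lowerOrthant_updateCoord v y i)
  have hae : ∀ᵐ p ∂(μ.prod (volume.restrict (Set.Ioc (-R) R))), p.2 ∈ Set.Ioc (-R) R :=
    Measure.quasiMeasurePreserving_snd.ae (ae_restrict_mem measurableSet_Ioc)
  refine Integrable.of_bound hm.aestronglyMeasurable b ?_
  filter_upwards [hae] with p hp
  refine (norm_indicator_le_norm_self _ _).trans (hb _ _ ?_)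
  exact abs_mixClamp_le hR _ _ _ (abs_updateCoord_le hy i (abs_le.2 ⟨hp.1.le, hp.2⟩))

lemma integrable_orthant (hg : IsMixedPartials f g) (hR : 0 ≤ R)
    (hb : ∀ u x, (∀ j, |x j| ≤ R) → |g u x| ≤ b) (μ : Measure (RSp d)) [IsFiniteMeasure μ]
    (s v : Finset (Fin d)) {y : RSp d} (hy : ∀ j, |y j| ≤ R) :
    Integrable (fun x => (lowerOrthant v y).indicator (fun x => g v (mixClamp R s x y)) x) μ := by
  have hc : Continuous fun x : RSp d => mixClamp R s x y := by
    refine (PiLp.continuous_toLp 2 _).comp (continuous_pi fun j => ?_)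
    have h := continuous_clamp R
    split_ifs <;> fun_prop
  refine Integrable.of_bound (((hg.2.1 v).comp hc).measurable.indicator
    (measurableSet_lowerOrthant v y)).aestronglyMeasurable b (Filter.Eventually.of_forall ?_)
  intro x
  exact (norm_indicator_le_norm_self _ _).trans (hb _ _ (abs_mixClamp_le hR _ _ _ hy))

/-- By `eval_clamp_eq` in coordinate `i` and Fubini, a clamped coordinate is traded for a frozen
one: either frozen at `R`, or frozen at `t` with one more derivative and the constraint `x i < t`.
-/
lemma orthantIntegral_insert (hg : IsMixedPartials f g) (hR : 0 ≤ R)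
    (hb : ∀ u x, (∀ j, |x j| ≤ R) → |g u x| ≤ b) (μ : Measure (RSp d)) [IsFiniteMeasure μ]
    {s v : Finset (Fin d)} {i : Fin d} (his : i ∉ s) (hiv : i ∉ v)
    {y : RSp d} (hy : ∀ j, |y j| ≤ R) :
    orthantIntegral g R μ (insert i s) v y = orthantIntegral g R μ s v (updateCoord y i R) -
      ∫ t in Set.Ioc (-R) R, orthantIntegral g R μ s (insert i v) (updateCoord y i t) := by
  have hint := integrable_orthant_prod hg hR hb μ s (insert i v) i hy
  have hv : ∀ t, lowerOrthant v (updateCoord y i t) = lowerOrthant v y := by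
    intro t; ext x
    refine forall₂_congr fun j hj => ?_
    rw [updateCoord_apply, if_neg (ne_of_mem_of_not_mem hj hiv)]
  unfold orthantIntegral
  rw [← integral_integral_swap hint, ← integral_sub]
  · congr 1
    ext x
    rw [hv]
    by_cases hx : x ∈ lowerOrthant v y
    · rw [Set.indicator_of_mem hx, Set.indicator_of_mem hx, mixClamp_insert R his,
        eval_clamp_eq (hg.hasDerivAt_mixClamp R his hiv x y) _ hR (x i)]
      · congr 2
        ext t
        have : (x ∈ lowerOrthant (insert i v) (updateCoord y i t)) ↔ t ∈ Set.Ioi (x i) := by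
          rw [← hv t] at hx
          simp only [lowerOrthant, Set.mem_ofPred_eq, Finset.forall_mem_insert, updateCoord_apply,
            if_true, Set.mem_Ioi]
          exact and_iff_left (by simpa [lowerOrthant] using hx)
        by_cases h : t ∈ Set.Ioi (x i)
        · rw [Set.indicator_of_mem h, Set.indicator_of_mem (this.2 h)]
        · rw [Set.indicator_of_notMem h, Set.indicator_of_notMem (fun h' => h (this.1 h'))]
      · exact (hg.2.1 _).comp ((continuous_mixClamp_updateCoord R s y i).comp
          (Continuous.prodMk continuous_const continuous_id))
    -- Outside the orthant of `v` the smaller orthant of `insert i v` is missed for every `t`, so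
    -- all terms vanish.
    · rw [Set.indicator_of_notMem hx, Set.indicator_of_notMem hx]
      rw [eq_comm, sub_eq_zero, eq_comm]
      refine integral_eq_zero_of_ae (Filter.Eventually.of_forall fun t => ?_)
      refine Set.indicator_of_notMem (fun h => hx ?_) _
      rw [← hv t]
      exact fun j hj => h j (Finset.mem_insert_of_mem hj)
  · exact integrable_orthant hg hR hb μ s v
      (abs_updateCoord_le hy i (abs_of_nonneg hR).le)
  · exact hint.integral_prod_left

/-- Induction on the clamped coordinates. Each one costs a factor `1 + 2R`: `1` for the endpoint
term and `2R` for the length of the integration interval. With none left the integrand is constant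
on an orthant, and only the two measures of that orthant are compared. -/
theorem abs_orthantIntegral_sub_le (hg : IsMixedPartials f g) (hR : 0 ≤ R)
    (hb : ∀ u x, (∀ j, |x j| ≤ R) → |g u x| ≤ b) (μ ν : Measure (RSp d)) [IsFiniteMeasure μ]
    [IsFiniteMeasure ν] {D : ℝ}
    (hD : ∀ v y, |μ.real (lowerOrthant v y) - ν.real (lowerOrthant v y)| ≤ D)
    (s : Finset (Fin d)) :
    ∀ v, Disjoint s v → ∀ y : RSp d, (∀ j, |y j| ≤ R) →
      |orthantIntegral g R μ s v y - orthantIntegral g R ν s v y|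
        ≤ (1 + 2 * R) ^ s.card * (b * D) := by
  induction s using Finset.induction_on with
  | empty =>
    intro v _ y hy
    have hI : ∀ μ : Measure (RSp d), orthantIntegral g R μ ∅ v y =
        μ.real (lowerOrthant v y) * g v y := by
      intro μ
      have : ∀ x, mixClamp R ∅ x y = y := fun x => by ext j; simp
      simp only [orthantIntegral, this]
      rw [integral_indicator_const _ (measurableSet_lowerOrthant v y), smul_eq_mul]
    rw [hI, hI, ← sub_mul, abs_mul, mul_comm]
    simp only [Finset.card_empty, pow_zero, one_mul]
    have h1 := hb v y hy
    exact mul_le_mul h1 (hD v y) (abs_nonneg _) ((abs_nonneg _).trans h1)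
  | insert i s his ih =>
    intro v hdis y hy
    rw [Finset.disjoint_insert_left] at hdis
    obtain ⟨hiv, hdis⟩ := hdis
    have hint : ∀ (μ : Measure (RSp d)) [IsFiniteMeasure μ], Integrable (fun t =>
        orthantIntegral g R μ s (insert i v) (updateCoord y i t))
        (volume.restrict (Set.Ioc (-R) R)) := fun μ _ =>
      (integrable_orthant_prod hg hR hb μ s (insert i v) i hy).integral_prod_right
    rw [orthantIntegral_insert hg hR hb μ his hiv hy, orthantIntegral_insert hg hR hb ν his hiv hy,
      sub_sub_sub_comm, ← integral_sub (hint μ) (hint ν)]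
    have h1 := ih v hdis (updateCoord y i R) (abs_updateCoord_le hy i (abs_of_nonneg hR).le)
    have h2 : ‖∫ t in Set.Ioc (-R) R, (orthantIntegral g R μ s (insert i v) (updateCoord y i t) -
        orthantIntegral g R ν s (insert i v) (updateCoord y i t))‖ ≤
        (1 + 2 * R) ^ s.card * (b * D) * volume.real (Set.Ioc (-R) R) := by
      refine norm_setIntegral_le_of_norm_le_const (by simp) fun t ht => ?_
      exact ih _ (Finset.disjoint_insert_right.2 ⟨his, hdis⟩) _
        (abs_updateCoord_le hy i (abs_le.2 ⟨ht.1.le, ht.2⟩))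
    rw [Real.volume_real_Ioc_of_le (by linarith), Real.norm_eq_abs] at h2
    refine (abs_sub _ _).trans ((add_le_add h1 h2).trans ?_)
    rw [Finset.card_insert_of_notMem his, pow_succ]
    apply le_of_eq; ring

/-- A Koksma–Hlawka inequality on `ℝ^d` for a function composed with the projection onto the cube
`[-R, R]^d`. -/
theorem abs_integral_clampBox_sub_le (hg : IsMixedPartials f g) (hR : 0 ≤ R)
    (hb : ∀ u x, (∀ j, |x j| ≤ R) → |g u x| ≤ b) (μ ν : Measure (RSp d)) [IsFiniteMeasure μ]
    [IsFiniteMeasure ν] {D : ℝ}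
    (hD : ∀ v y, |μ.real (lowerOrthant v y) - ν.real (lowerOrthant v y)| ≤ D) :
    |∫ x, f (clampBox R x) ∂μ - ∫ x, f (clampBox R x) ∂ν| ≤ (1 + 2 * R) ^ d * (b * D) := by
  -- All coordinates are clamped, so the frozen point `0` is a dummy.
  have h := abs_orthantIntegral_sub_le hg hR hb μ ν hD Finset.univ ∅ (by simp) 0
    (fun _ => by simpa using hR)
  have hI : ∀ μ : Measure (RSp d), orthantIntegral g R μ Finset.univ ∅ 0 =
      ∫ x, f (clampBox R x) ∂μ := by
    intro μ
    have h1 : ∀ x, mixClamp R Finset.univ x (0 : RSp d) = clampBox R x :=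
      fun x => by ext j; simp
    have h2 : lowerOrthant (∅ : Finset (Fin d)) (0 : RSp d) = Set.univ := by
      ext; simp [lowerOrthant]
    simp only [orthantIntegral, h1, h2, Set.indicator_univ, hg.1]
  simpa [hI] using h

end KoksmaHlawka

-- The normal distribution function as a transport to the cube

local notation "Φ" => cdf (gaussianReal 0 1)

/-- If `Φ` were constant on `[a, b]`, the interval would be Gaussian-null and hence Lebesgue-null.
-/
lemma strictMono_cdf_gaussianReal : StrictMono Φ := by
  refine fun a b hab => lt_of_le_of_ne (monotone_cdf _ hab.le) fun h => ?_
  have h1 : gaussianReal 0 1 (Set.Ioc a b) = 0 := by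
    rw [← measure_cdf (gaussianReal 0 1), StieltjesFunction.measure_Ioc, h]
    simp
  have h2 := gaussianReal_absolutelyContinuous' 0 (one_ne_zero) h1
  simp [Real.volume_Ioc] at h2
  linarith

lemma continuous_cdf_gaussianReal : Continuous Φ := by
  rw [continuous_iff_continuousAt]
  intro x
  rw [(monotone_cdf _).continuousAt_iff_leftLim_eq_rightLim,
    StieltjesFunction.rightLim_eq]
  refine le_antisymm ((monotone_cdf _).leftLim_le le_rfl) ?_
  have := nullSingletonClass_gaussianReal (μ := 0) (v := 1) one_ne_zero
  have h : (cdf (gaussianReal 0 1)).measure {x} = 0 := by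
    rw [measure_cdf]; exact measure_singleton x
  rw [StieltjesFunction.measure_singleton, ENNReal.ofReal_eq_zero] at h
  linarith

lemma cdf_gaussianReal_pos (x : ℝ) : 0 < Φ x :=
  (cdf_nonneg _ (x - 1)).trans_lt (strictMono_cdf_gaussianReal (by linarith))

lemma cdf_gaussianReal_lt_one (x : ℝ) : Φ x < 1 :=
  (strictMono_cdf_gaussianReal (lt_add_one x)).trans_le (cdf_le_one _ _)

lemma exists_cdf_gaussianReal_eq {a : ℝ} (h0 : 0 < a) (h1 : a < 1) : ∃ x, Φ x = a :=
  mem_range_of_exists_le_of_exists_ge continuous_cdf_gaussianReal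
    (((tendsto_cdf_atBot _).eventually (eventually_le_nhds h0)).exists)
    (((tendsto_cdf_atTop _).eventually (eventually_ge_nhds h1)).exists)

/-- The probability integral transform for the standard normal distribution. -/
lemma map_cdf_gaussianReal : (gaussianReal 0 1).map Φ = volume.restrict (Set.Ico 0 1) := by
  have : IsProbabilityMeasure ((gaussianReal 0 1).map Φ) :=
    Measure.isProbabilityMeasure_map continuous_cdf_gaussianReal.aemeasurable
  refine Measure.ext_of_Iic _ _ fun a => ?_
  rw [Measure.map_apply continuous_cdf_gaussianReal.measurable measurableSet_Iic,
    Measure.restrict_apply measurableSet_Iic]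
  rcases le_or_gt a 0 with ha | ha
  · have h1 : (⇑Φ) ⁻¹' Set.Iic a = ∅ := by
      ext x; simpa using ha.trans_lt (cdf_gaussianReal_pos x)
    have h2 : Set.Iic a ∩ Set.Ico 0 1 ⊆ {0} := by
      rintro x ⟨hx, hx'⟩; exact le_antisymm (le_trans hx ha) hx'.1
    rw [h1, measure_empty, measure_mono_null h2 (by simp)]
  rcases le_or_gt 1 a with ha1 | ha1
  · have h1 : (⇑Φ) ⁻¹' Set.Iic a = Set.univ := by
      ext x; simpa using (cdf_le_one _ x).trans ha1
    have h2 : Set.Iic a ∩ Set.Ico 0 1 = Set.Ico 0 1 :=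
      Set.inter_eq_right.2 fun x hx => hx.2.le.trans ha1
    rw [h1, h2]; simp
  · obtain ⟨y, rfl⟩ := exists_cdf_gaussianReal_eq ha ha1
    have h1 : (⇑Φ) ⁻¹' Set.Iic (Φ y) = Set.Iic y := by
      ext x; simp [strictMono_cdf_gaussianReal.le_iff_le]
    have h2 : Set.Iic (Φ y) ∩ Set.Ico 0 1 = Set.Icc 0 (Φ y) := by
      ext x
      simp only [Set.mem_inter_iff, Set.mem_Iic, Set.mem_Ico, Set.mem_Icc]
      exact ⟨fun h => ⟨h.2.1, h.1⟩, fun h => ⟨h.2, h.1, h.2.trans_lt ha1⟩⟩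
    rw [h1, h2, Real.volume_Icc, sub_zero, ofReal_cdf]

lemma continuous_stdNormalCDF {d : ℕ} : Continuous (stdNormalCDF (d := d)) := by
  refine (PiLp.continuous_toLp 2 _).comp (continuous_pi fun j => ?_)
  exact continuous_cdf_gaussianReal.comp (by fun_prop)

lemma measurableSet_unitCube (d : ℕ) : MeasurableSet (unitCube d) := by
  have : unitCube d = ⋂ j, {y : RSp d | 0 ≤ y j ∧ y j < 1} := by
    ext; simp [unitCube]
  rw [this]
  refine MeasurableSet.iInter fun j => MeasurableSet.inter (s₁ := {y : RSp d | 0 ≤ y j})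
    (s₂ := {y : RSp d | y j < 1}) ?_ ?_
  exacts [measurableSet_le (by fun_prop) (by fun_prop),
    measurableSet_lt (by fun_prop) (by fun_prop)]

lemma map_stdNormalCDF (d : ℕ) :
    (stdGaussian (RSp d)).map stdNormalCDF = uniformCube d := by
  have hm : Measurable (WithLp.toLp 2 : (Fin d → ℝ) → RSp d) := by fun_prop
  have hΦ := continuous_cdf_gaussianReal.measurable
  rw [← map_pi_eq_stdGaussian, Measure.map_map continuous_stdNormalCDF.measurable hm]
  have h1 : (stdNormalCDF ∘ WithLp.toLp 2 : (Fin d → ℝ) → RSp d) =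
      WithLp.toLp 2 ∘ fun x j => Φ (x j) := rfl
  have h2 : Measure.map (fun (x : Fin d → ℝ) j => Φ (x j))
      (Measure.pi fun _ => gaussianReal 0 1) = Measure.pi fun _ => volume.restrict (Set.Ico 0 1) := by
    have : ∀ _ : Fin d, SigmaFinite (Measure.map Φ (gaussianReal 0 1)) := by
      intro _; rw [map_cdf_gaussianReal]; infer_instance
    rw [Measure.pi_map_pi fun _ => hΦ.aemeasurable, map_cdf_gaussianReal]
  rw [h1, ← Measure.map_map hm (by fun_prop), h2, ← Measure.restrict_pi_pi, ← volume_pi]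
  have h3 := (PiLp.volume_preserving_toLp (Fin d)).restrict_preimage (measurableSet_unitCube d)
  have h4 : (WithLp.toLp 2 : (Fin d → ℝ) → RSp d) ⁻¹' unitCube d =
      Set.univ.pi fun _ => Set.Ico 0 1 := by
    ext x; simp [unitCube, Set.mem_pi]
  rw [h4] at h3
  exact h3.map_eq

instance (d : ℕ) : IsProbabilityMeasure (uniformCube d) := by
  rw [← map_stdNormalCDF]
  exact Measure.isProbabilityMeasure_map continuous_stdNormalCDF.aemeasurable

lemma stdGaussian_real_lowerOrthant {d : ℕ} (v : Finset (Fin d)) (y : RSp d) :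
    (stdGaussian (RSp d)).real (lowerOrthant v y) = ∏ j, if j ∈ v then Φ (y j) else 1 := by
  have := nullSingletonClass_gaussianReal (μ := 0) (v := 1) one_ne_zero
  have hm : Measurable (WithLp.toLp 2 : (Fin d → ℝ) → RSp d) := by fun_prop
  rw [← map_pi_eq_stdGaussian, map_measureReal_apply hm (measurableSet_lowerOrthant v y)]
  have h : (WithLp.toLp 2 : (Fin d → ℝ) → RSp d) ⁻¹' lowerOrthant v y =
      Set.univ.pi fun j => if j ∈ v then Set.Iio (y j) else Set.univ := by
    ext x
    simp only [lowerOrthant, Set.mem_preimage, Set.mem_ofPred_eq, Set.mem_pi, Set.mem_univ,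
      forall_const]
    refine forall_congr' fun j => ?_
    split_ifs with hj <;> simp [hj]
  rw [h, measureReal_def, Measure.pi_pi, ENNReal.toReal_prod]
  refine Finset.prod_congr rfl fun j _ => ?_
  split_ifs
  · rw [measure_congr Iio_ae_eq_Iic, cdf_eq_real, measureReal_def]
  · simp

/-! ### Gaussian tails, moments and the truncation error -/

lemma hasSubgaussianMGF_gaussianReal : HasSubgaussianMGF (fun x : ℝ => x) 1 (gaussianReal 0 1) where
  integrable_exp_mul t := integrable_exp_mul_gaussianReal t
  mgf_le t := by rw [mgf_fun_id_gaussianReal]; simp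

lemma gaussianReal_abs_gt_le {R : ℝ} (hR : 0 ≤ R) :
    (gaussianReal 0 1).real {x | R < |x|} ≤ 2 * Real.exp (-R ^ 2 / 2) := by
  have h1 := hasSubgaussianMGF_gaussianReal.measure_ge_le hR
  have h2 := hasSubgaussianMGF_gaussianReal.neg.measure_ge_le hR
  have h3 : {x : ℝ | R < |x|} ⊆ {x | R ≤ x} ∪ {x | R ≤ -x} := fun x hx => by
    rcases lt_abs.1 (show R < |x| from hx) with h | h
    exacts [Or.inl h.le, Or.inr h.le]
  refine (measureReal_mono h3).trans ((measureReal_union_le _ _).trans ?_)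
  simp only [NNReal.coe_one, mul_one, Pi.neg_apply] at h1 h2
  linarith

lemma stdGaussian_compl_box_le {d : ℕ} {R : ℝ} (hR : 0 ≤ R) :
    (stdGaussian (RSp d)).real {x | ∀ j, |x j| ≤ R}ᶜ ≤ 2 * d * Real.exp (-R ^ 2 / 2) := by
  have hm : Measurable (WithLp.toLp 2 : (Fin d → ℝ) → RSp d) := by fun_prop
  have h1 : ({x | ∀ j, |x j| ≤ R}ᶜ : Set (RSp d)) = ⋃ j, {x | R < |x j|} := by
    ext x; simp
  have h2 : ∀ j, (stdGaussian (RSp d)).real {x | R < |x j|} ≤ 2 * Real.exp (-R ^ 2 / 2) := by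
    intro j
    have hj : MeasurableSet {x : ℝ | R < |x|} := measurableSet_lt (by fun_prop) (by fun_prop)
    have hS : MeasurableSet {x : RSp d | R < |x j|} :=
      measurableSet_lt (by fun_prop) (by fun_prop)
    refine le_trans (le_of_eq ?_) (gaussianReal_abs_gt_le hR)
    rw [← map_pi_eq_stdGaussian, map_measureReal_apply hm hS]
    exact (measurePreserving_eval (fun _ : Fin d => gaussianReal 0 1) j).measureReal_preimage
      hj.nullMeasurableSet
  rw [h1]
  refine (measureReal_iUnion_fintype_le _).trans ((Finset.sum_le_sum fun j _ => h2 j).trans ?_)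
  simp only [Finset.sum_const, Finset.card_univ, Fintype.card_fin, nsmul_eq_mul]
  apply le_of_eq; ring

/-- The threshold `r₀` is where `M r^k = c r^2`; beyond it the quadratic term dominates because `k <
2`. -/
lemma exists_mul_rpow_le {M k c : ℝ} (hM : 0 < M) (hk : 0 < k) (hk2 : k < 2) (hc : 0 < c) :
    ∃ b, ∀ r, 0 ≤ r → M * r ^ k ≤ c * r ^ 2 + b := by
  set r₀ := (M / c) ^ (2 - k)⁻¹ with hr₀
  have h0 : 0 < r₀ := by positivity
  refine ⟨M * r₀ ^ k, fun r hr => ?_⟩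
  rcases le_total r r₀ with h | h
  · have : r ^ k ≤ r₀ ^ k := by gcongr
    have h2 : 0 ≤ c * r ^ 2 := by positivity
    nlinarith
  · have hpos : 0 < r := h0.trans_le h
    have h1 : M / c ≤ r ^ (2 - k) := by
      have : r₀ ^ (2 - k) ≤ r ^ (2 - k) := Real.rpow_le_rpow h0.le h (by linarith)
      rwa [hr₀, ← Real.rpow_mul (by positivity), inv_mul_cancel₀ (by linarith), Real.rpow_one]
        at this
    have h2 : r ^ 2 = r ^ (2 - k) * r ^ k := by
      rw [← Real.rpow_add hpos, ← Real.rpow_natCast]; norm_num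
    rw [div_le_iff₀ hc] at h1
    have h3 : 0 ≤ M * r₀ ^ k := by positivity
    have h4 : M * r ^ k ≤ r ^ (2 - k) * c * r ^ k := by gcongr
    rw [h2]; linarith

/-- Fernique's theorem makes `exp (c ‖x‖^2)` integrable for some `c > 0`, and `p M ‖x‖^k` exceeds `c
‖x‖^2` by at most a constant. -/
lemma memLp_exp_norm_rpow {d : ℕ} {M k p : ℝ} (hM : 0 < M) (hk : 0 < k) (hk2 : k < 2)
    (hp : 0 < p) :
    MemLp (fun x : RSp d => Real.exp (M * ‖x‖ ^ k)) (ENNReal.ofReal p) (stdGaussian (RSp d)) := by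
  obtain ⟨c, hc, hint⟩ := IsGaussian.exists_integrable_exp_sq (stdGaussian (RSp d))
  obtain ⟨b, hb⟩ := exists_mul_rpow_le (M := p * M) (by positivity) hk hk2 hc
  have hm : Continuous (fun x : RSp d => Real.exp (M * ‖x‖ ^ k)) :=
    Real.continuous_exp.comp (continuous_const.mul
      (continuous_norm.rpow_const fun _ => Or.inr hk.le))
  rw [← integrable_norm_rpow_iff hm.aestronglyMeasurable (by simpa using hp) (by simp),
    ENNReal.toReal_ofReal hp.le]
  refine (hint.mul_const (Real.exp b)).mono'
    (hm.norm.rpow_const fun _ => Or.inr hp.le).aestronglyMeasurable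
    (Filter.Eventually.of_forall fun x => ?_)
  rw [Real.norm_of_nonneg (by positivity), Real.norm_of_nonneg (by positivity), ← Real.exp_mul,
    ← Real.exp_add, Real.exp_le_exp]
  have := hb ‖x‖ (norm_nonneg x)
  linarith

lemma norm_clampBox_le {d : ℕ} {R : ℝ} (hR : 0 ≤ R) (x : RSp d) : ‖clampBox R x‖ ≤ ‖x‖ := by
  rw [EuclideanSpace.norm_eq, EuclideanSpace.norm_eq]
  refine Real.sqrt_le_sqrt (Finset.sum_le_sum fun j _ => ?_)
  exact pow_le_pow_left₀ (norm_nonneg _) (abs_clamp_le_abs hR _) 2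

/-- The `L^q` norm under the standard normal distribution of the error caused by projecting the
argument onto the cube with half side `2 √(q log n)` is of order `1/n`. -/
theorem exists_eLpNorm_sub_clampBox_le (d : ℕ) {M B k q : ℝ} (hM : 0 < M) (hB : 0 < B)
    (hk : 0 < k) (hk2 : k < 2) (hq : 0 < q) :
    ∃ K : ℝ, 0 < K ∧ ∀ f : RSp d → ℝ,
      (∀ x, |f x| ≤ B * Real.exp (M * ‖x‖ ^ k)) → ∀ n : ℕ, 1 ≤ n →
      eLpNorm (fun x => f x - f (clampBox (2 * √(q * Real.log n)) x)) (ENNReal.ofReal q)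
        (stdGaussian (RSp d)) ≤ ENNReal.ofReal (K / n) := by
  -- The factor 2 covers both `f x` and `f (clampBox R x)`, as projecting does not increase the
  -- norm.
  set E : RSp d → ℝ := fun x => 2 * B * Real.exp (M * ‖x‖ ^ k) with hE
  have hEm : MemLp E (ENNReal.ofReal (2 * q)) (stdGaussian (RSp d)) :=
    (memLp_exp_norm_rpow hM hk hk2 (by positivity)).const_mul _
  set S := (eLpNorm E (ENNReal.ofReal (2 * q)) (stdGaussian (RSp d))).toReal
  have hS : eLpNorm E (ENNReal.ofReal (2 * q)) (stdGaussian (RSp d)) = ENNReal.ofReal S :=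
    (ENNReal.ofReal_toReal hEm.2.ne).symm
  have hS0 : 0 ≤ S := ENNReal.toReal_nonneg
  -- The summand 1 only keeps the constant positive.
  refine ⟨(2 * d) ^ (1 / (2 * q)) * S + 1, by positivity, fun f hfb n hn => ?_⟩
  set R := 2 * √(q * Real.log n) with hRdef
  have hlog : 0 ≤ Real.log n := Real.log_natCast_nonneg n
  have hR : 0 ≤ R := by positivity
  have hn0 : (0 : ℝ) < n := by exact_mod_cast hn
  set S' : Set (RSp d) := {x | ∀ j, |x j| ≤ R}ᶜ with hS'
  have hS'm : MeasurableSet S' := by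
    have : {x : RSp d | ∀ j, |x j| ≤ R} = ⋂ j, {x | |x j| ≤ R} := by ext; simp
    rw [hS', this]
    exact (MeasurableSet.iInter fun j => measurableSet_le (by fun_prop) (by fun_prop)).compl
  have hpt : ∀ x, ‖f x - f (clampBox R x)‖ ≤ ‖((S'.indicator fun _ => (1 : ℝ)) • E) x‖ := by
    intro x
    by_cases hx : x ∈ S'
    · have h1 : ‖clampBox R x‖ ^ k ≤ ‖x‖ ^ k :=
        Real.rpow_le_rpow (norm_nonneg _) (norm_clampBox_le hR x) hk.le
      have h2 : |f (clampBox R x)| ≤ B * Real.exp (M * ‖x‖ ^ k) :=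
        (hfb _).trans (by gcongr)
      have h3 : (0 : ℝ) ≤ E x := by positivity
      simp only [Pi.smul_apply', Set.indicator_of_mem hx, one_smul]
      rw [Real.norm_of_nonneg h3, Real.norm_eq_abs]
      refine (abs_sub _ _).trans ?_
      have := hfb x
      simp only [hE]; linarith
    · have : clampBox R x = x := by
        ext j; exact clamp_of_abs_le (by simp [hS'] at hx; exact hx j)
      simp only [this, sub_self, norm_zero, norm_nonneg]
  have : ENNReal.HolderTriple (ENNReal.ofReal (2 * q)) (ENNReal.ofReal (2 * q))
      (ENNReal.ofReal q) := by
    constructor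
    rw [← ENNReal.ofReal_inv_of_pos (by positivity), ← ENNReal.ofReal_inv_of_pos hq,
      ← ENNReal.ofReal_add (by positivity) (by positivity)]
    congr 1; field_simp; norm_num
  refine (eLpNorm_mono hpt).trans ((eLpNorm_smul_le_mul_eLpNorm (p := ENNReal.ofReal (2 * q))
    (q := ENNReal.ofReal (2 * q)) hEm.1
    (aestronglyMeasurable_const.indicator hS'm)).trans ?_)
  rw [eLpNorm_indicator_const hS'm (by simpa using hq) ENNReal.ofReal_ne_top, hS,
    ENNReal.toReal_ofReal (by positivity), ← ofReal_measureReal, enorm_one, one_mul,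
    ENNReal.ofReal_rpow_of_nonneg measureReal_nonneg (by positivity),
    ← ENNReal.ofReal_mul (by positivity)]
  refine ENNReal.ofReal_le_ofReal ?_
  have h1 : (stdGaussian (RSp d)).real S' ^ (1 / (2 * q)) ≤ (2 * d) ^ (1 / (2 * q)) / n := by
    refine (Real.rpow_le_rpow measureReal_nonneg (stdGaussian_compl_box_le hR)
      (by positivity)).trans (le_of_eq ?_)
    rw [Real.mul_rpow (by positivity) (by positivity), ← Real.exp_mul,
      div_eq_mul_inv _ (n : ℝ)]
    congr 1
    -- This identity dictates `R`: the `2q`-th root of `exp (-R^2 / 2)` is exactly `1/n`.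
    have : -R ^ 2 / 2 * (1 / (2 * q)) = -Real.log n := by
      rw [hRdef, mul_pow, Real.sq_sqrt (by positivity)]; field_simp
    rw [this, Real.exp_neg, Real.exp_log hn0]
  calc _ ≤ (2 * d) ^ (1 / (2 * q)) / n * S := by gcongr
    _ ≤ ((2 * d) ^ (1 / (2 * q)) * S + 1) / n := by
      rw [div_mul_eq_mul_div]; gcongr; linarith

/-! ### Empirical measures and the star discrepancy -/

/-- The empirical distribution of the points `x_1, …, x_n`. -/
noncomputable def empiricalMeasure {α : Type*} [MeasurableSpace α] {n : ℕ} (x : Fin n → α) :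
    Measure α :=
  (n : ENNReal)⁻¹ • ∑ i, Measure.dirac (x i)

lemma isProbabilityMeasure_empiricalMeasure {α : Type*} [MeasurableSpace α] {n : ℕ} (hn : n ≠ 0)
    (x : Fin n → α) : IsProbabilityMeasure (empiricalMeasure x) := by
  constructor
  simp only [empiricalMeasure, Measure.smul_apply, Measure.finsetSum_apply, measure_univ,
    Finset.sum_const, Finset.card_univ, Fintype.card_fin, nsmul_eq_mul, mul_one, smul_eq_mul]
  exact ENNReal.inv_mul_cancel (by exact_mod_cast hn) (ENNReal.natCast_ne_top n)

lemma integral_empiricalMeasure {d n : ℕ} (x : Fin n → RSp d) (f : RSp d → ℝ) :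
    ∫ y, f y ∂(empiricalMeasure x) = (n : ℝ)⁻¹ * ∑ i, f (x i) := by
  rw [empiricalMeasure, integral_smul_measure, integral_finsetSum_measure]
  · simp
  · intro i _
    exact integrable_dirac (by simp)

open Classical in
lemma empiricalMeasure_real {α : Type*} [MeasurableSpace α] {n : ℕ} (x : Fin n → α) {s : Set α}
    (hs : MeasurableSet s) :
    (empiricalMeasure x).real s = ((Finset.univ.filter fun i => x i ∈ s).card : ℝ) / n := by
  have : ∑ i, (Measure.dirac (x i)) s = ((Finset.univ.filter fun i => x i ∈ s).card : ENNReal) := by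
    simp only [Measure.dirac_apply' _ hs, Set.indicator_apply, Pi.one_apply]
    rw [Finset.sum_boole]
  rw [measureReal_def, empiricalMeasure, Measure.smul_apply, Measure.finsetSum_apply, this]
  simp [div_eq_inv_mul]

open Classical in
lemma le_starDiscrepancy {n d : ℕ} (y : Fin n → RSp d) (a : Fin d → ℝ)
    (ha : ∀ j, 0 ≤ a j ∧ a j ≤ 1) :
    |((Finset.univ.filter fun i => ∀ j, 0 ≤ y i j ∧ y i j < a j).card : ℝ) / n - ∏ j, a j|
      ≤ starDiscrepancy y := by
  refine le_ciSup (f := fun a : {a : Fin d → ℝ // ∀ j, 0 ≤ a j ∧ a j ≤ 1} =>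
    |((Finset.univ.filter fun i => ∀ j, 0 ≤ y i j ∧ y i j < a.1 j).card : ℝ) / n - ∏ j, a.1 j|)
    ⟨1, ?_⟩ ⟨a, ha⟩
  rintro _ ⟨b, rfl⟩
  have h1 : (0 : ℝ) ≤ ∏ j, b.1 j := Finset.prod_nonneg fun j _ => (b.2 j).1
  have h2 : ∏ j, b.1 j ≤ 1 := Finset.prod_le_one (fun j _ => (b.2 j).1) fun j _ => (b.2 j).2
  have h3 : ((Finset.univ.filter fun i => ∀ j, 0 ≤ y i j ∧ y i j < b.1 j).card : ℝ) ≤ n := by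
    exact_mod_cast (Finset.card_filter_le _ _).trans (by simp)
  have h4 := div_le_one_of_le₀ h3 (Nat.cast_nonneg n)
  have h5 : (0 : ℝ) ≤
      ((Finset.univ.filter fun i => ∀ j, 0 ≤ y i j ∧ y i j < b.1 j).card : ℝ) / n := by positivity
  exact abs_le.2 ⟨by linarith, by linarith⟩

@[simp] lemma stdNormalCDF_apply {d : ℕ} (x : RSp d) (j : Fin d) : stdNormalCDF x j = Φ (x j) :=
  rfl

/-- `Φ` is strictly increasing, so it carries open orthants to half-open anchored boxes. An
unconstrained coordinate gets side length 1, which is no constraint since `Φ < 1`. -/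
lemma abs_empiricalMeasure_lowerOrthant_sub_le {n d : ℕ} (x : Fin n → RSp d)
    (v : Finset (Fin d)) (y : RSp d) :
    |(empiricalMeasure x).real (lowerOrthant v y) - (stdGaussian (RSp d)).real (lowerOrthant v y)|
      ≤ starDiscrepancy fun i => stdNormalCDF (x i) := by
  classical
  rw [empiricalMeasure_real _ (measurableSet_lowerOrthant v y), stdGaussian_real_lowerOrthant]
  refine le_trans (le_of_eq ?_) (le_starDiscrepancy (fun i => stdNormalCDF (x i))
    (fun j => if j ∈ v then Φ (y j) else 1) fun j => ?_)
  · have : ∀ i, x i ∈ lowerOrthant v y ↔ ∀ j, 0 ≤ stdNormalCDF (x i) j ∧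
        stdNormalCDF (x i) j < if j ∈ v then Φ (y j) else 1 := by
      intro i
      refine forall_congr' fun j => ?_
      rw [stdNormalCDF_apply, and_iff_right (cdf_nonneg _ _)]
      split_ifs with hj
      · simp [hj, strictMono_cdf_gaussianReal.lt_iff_lt]
      · simp [hj, cdf_gaussianReal_lt_one]
    simp only [this]
  · split_ifs
    exacts [⟨cdf_nonneg _ _, cdf_le_one _ _⟩, ⟨zero_le_one, le_rfl⟩]

/-! ### Quadrature error for a fixed integrand -/

/-- The projection of the unit cube onto `[Φ(-R), Φ(R)]^d`. -/
noncomputable def clampCube {d : ℕ} (R : ℝ) (u : RSp d) : RSp d :=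
  WithLp.toLp 2 fun j => max (Φ (-R)) (min (u j) (Φ R))

lemma measurable_clampCube {d : ℕ} (R : ℝ) : Measurable (clampCube (d := d) R) := by
  unfold clampCube; fun_prop

lemma clampCube_stdNormalCDF {d : ℕ} (R : ℝ) (x : RSp d) :
    clampCube R (stdNormalCDF x) = stdNormalCDF (clampBox R x) := by
  ext j
  change max (Φ (-R)) (min (Φ (x j)) (Φ R)) = Φ (max (-R) (min (x j) R))
  rw [(monotone_cdf _).map_max, (monotone_cdf _).map_min]

lemma exists_stdNormalCDF_eq {d : ℕ} {u : RSp d} (hu : ∀ j, 0 < u j ∧ u j < 1) :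
    ∃ x : RSp d, stdNormalCDF x = u := by
  choose x hx using fun j => exists_cdf_gaussianReal_eq (hu j).1 (hu j).2
  exact ⟨WithLp.toLp 2 x, by ext j; exact hx j⟩

lemma ae_uniformCube_mem_Ioo (d : ℕ) : ∀ᵐ u ∂(uniformCube d), ∀ j, 0 < u j ∧ u j < 1 := by
  have hm : MeasurableSet {u : RSp d | ∀ j, 0 < u j ∧ u j < 1} := by
    have : {u : RSp d | ∀ j, 0 < u j ∧ u j < 1} = ⋂ j, ({u | 0 < u j} ∩ {u | u j < 1}) := by
      ext; simp
    rw [this]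
    exact MeasurableSet.iInter fun j =>
      (measurableSet_lt (by fun_prop) (by fun_prop)).inter
        (measurableSet_lt (by fun_prop) (by fun_prop))
  rw [← map_stdNormalCDF, ae_map_iff continuous_stdNormalCDF.aemeasurable hm]
  exact Filter.Eventually.of_forall fun x j =>
    ⟨cdf_gaussianReal_pos _, cdf_gaussianReal_lt_one _⟩

lemma norm_rpow_le_of_mem_box {d : ℕ} {R k : ℝ} (hk : 0 ≤ k) {x : RSp d}
    (hx : ∀ j, |x j| ≤ R) : ‖x‖ ^ k ≤ (d * R ^ 2) ^ (k / 2) := by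
  have h1 : ‖x‖ ^ 2 ≤ d * R ^ 2 := by
    rw [EuclideanSpace.norm_sq_eq]
    refine (Finset.sum_le_sum fun j _ => pow_le_pow_left₀ (norm_nonneg _) (hx j) 2).trans ?_
    simp
  calc ‖x‖ ^ k = (‖x‖ ^ 2) ^ (k / 2) := by
        rw [← Real.rpow_natCast, ← Real.rpow_mul (norm_nonneg _)]; congr 1; push_cast; ring
    _ ≤ _ := Real.rpow_le_rpow (by positivity) h1 (by linarith)

/-- The quadrature error of a function of growth class `G_e(M, B, k)` projected onto the cube with
half side `2 √(q log n)`. -/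
theorem exists_abs_average_clampCube_sub_le {d : ℕ} (hd : 1 ≤ d) {M B k q : ℝ} (C : ℝ)
    (hM : 0 < M) (hB : 0 < B) (hk : 0 < k) (hq : 0 < q) :
    ∃ K : ℝ, 0 < K ∧ ∀ G : RSp d → ℝ, Measurable G → G ∘ stdNormalCDF ∈ GrowthClass d M B k →
      ∀ n : ℕ, 2 ≤ n → ∀ u : Fin n → RSp d, (∀ i j, 0 < u i j ∧ u i j < 1) →
      starDiscrepancy u ≤ C * Real.log n ^ (d - 1) / n →
      |(n : ℝ)⁻¹ * ∑ i, G (clampCube (2 * √(q * Real.log n)) (u i)) -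
        ∫ w, G (clampCube (2 * √(q * Real.log n)) w) ∂(uniformCube d)|
        ≤ K * thetaRate d M k q n := by
  have hl2 : 0 < Real.log 2 := Real.log_pos one_lt_two
  -- For `n ≥ 2` the 1 in `1 + 2R` is at most `√(log n) / √(log 2)`; `|C| + 1` keeps the constant
  -- positive for every real `C`.
  refine ⟨((√(Real.log 2))⁻¹ + 4 * √q) ^ d * (B * (|C| + 1)), by positivity, ?_⟩
  rintro G hG ⟨g, hg, hgb⟩ n hn u hu hdisc
  -- A coordinate equal to 0 has no preimage under `Φ`; hence the hypothesis that the points lie in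
  -- the open cube.
  choose x hx using fun i => exists_stdNormalCDF_eq (hu i)
  have hux : u = fun i => stdNormalCDF (x i) := funext fun i => (hx i).symm
  set R := 2 * √(q * Real.log n) with hRdef
  have hn0 : (0 : ℝ) < n := by positivity
  have hlog2 : Real.log 2 ≤ Real.log n := Real.log_le_log two_pos (by exact_mod_cast hn)
  have hlog : 0 < Real.log n := hl2.trans_le hlog2
  have hR : 0 ≤ R := by positivity
  have hprob := isProbabilityMeasure_empiricalMeasure (by omega : n ≠ 0) x
  have hR2 : (d : ℝ) * R ^ 2 = 4 * q * d * Real.log n := by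
    rw [hRdef, mul_pow, Real.sq_sqrt (by positivity)]; ring
  have hb : ∀ v y, (∀ j, |y j| ≤ R) →
      |g v y| ≤ B * Real.exp (M * (4 * q * d * Real.log n) ^ (k / 2)) := by
    intro v y hy
    have := norm_rpow_le_of_mem_box hk.le hy
    rw [hR2] at this
    exact (hgb v y).trans (by gcongr)
  have key := abs_integral_clampBox_sub_le hg hR hb (empiricalMeasure x) (stdGaussian (RSp d))
    (D := (|C| + 1) * Real.log n ^ (d - 1) / n) (fun v y => by
      refine (abs_empiricalMeasure_lowerOrthant_sub_le x v y).trans ?_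
      rw [← hux]
      refine hdisc.trans ?_
      have := le_abs_self C
      gcongr; linarith)
  have h1 : ∫ y, (G ∘ stdNormalCDF) (clampBox R y) ∂(empiricalMeasure x) =
      (n : ℝ)⁻¹ * ∑ i, G (clampCube R (u i)) := by
    rw [integral_empiricalMeasure]
    simp only [Function.comp_apply, ← clampCube_stdNormalCDF, hx]
  have h2 : ∫ y, (G ∘ stdNormalCDF) (clampBox R y) ∂(stdGaussian (RSp d)) =
      ∫ w, G (clampCube R w) ∂(uniformCube d) := by
    have hGc : Measurable fun w => G (clampCube R w) := hG.comp (measurable_clampCube R)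
    rw [← map_stdNormalCDF, integral_map continuous_stdNormalCDF.aemeasurable
      hGc.aestronglyMeasurable]
    simp only [Function.comp_apply, ← clampCube_stdNormalCDF]
  rw [h1, h2] at key
  refine key.trans ?_
  have h3 : (1 + 2 * R) ^ d ≤ ((√(Real.log 2))⁻¹ + 4 * √q) ^ d * Real.log n ^ ((d : ℝ) / 2) := by
    have h4 : Real.log n ^ ((d : ℝ) / 2) = √(Real.log n) ^ d := by
      rw [Real.sqrt_eq_rpow, ← Real.rpow_natCast, ← Real.rpow_mul hlog.le]; congr 1; ring
    rw [h4, ← mul_pow]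
    refine pow_le_pow_left₀ (by positivity) ?_ d
    have h5 : 1 ≤ (√(Real.log 2))⁻¹ * √(Real.log n) := by
      rw [inv_mul_eq_div, one_le_div (by positivity)]
      exact Real.sqrt_le_sqrt hlog2
    rw [hRdef, Real.sqrt_mul hq.le]
    linarith
  have h6 : Real.log n ^ (3 * (d : ℝ) / 2 - 1) =
      Real.log n ^ ((d : ℝ) / 2) * Real.log n ^ (d - 1) := by
    rw [← Real.rpow_natCast, ← Real.rpow_add hlog, Nat.cast_sub hd]
    congr 1; push_cast; ring
  rw [thetaRate, h6]
  refine (mul_le_mul_of_nonneg_right h3 (by positivity)).trans (le_of_eq ?_)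
  ring

/-- The exponent `3d/2 - 1` is positive and `log n ≥ log 2`, so the `1/n` truncation error is
absorbed into the rate. -/
lemma inv_le_thetaRate {d : ℕ} (hd : 1 ≤ d) {M k q : ℝ} (hM : 0 < M) (hq : 0 < q) {n : ℕ}
    (hn : 2 ≤ n) :
    (n : ℝ)⁻¹ ≤ (Real.log 2 ^ (3 * (d : ℝ) / 2 - 1))⁻¹ * thetaRate d M k q n := by
  have hl2 : 0 < Real.log 2 := Real.log_pos one_lt_two
  have hlog2 : Real.log 2 ≤ Real.log n := Real.log_le_log two_pos (by exact_mod_cast hn)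
  have hlog : 0 < Real.log n := hl2.trans_le hlog2
  have hd' : (1 : ℝ) ≤ d := by exact_mod_cast hd
  have h1 : Real.log 2 ^ (3 * (d : ℝ) / 2 - 1) ≤ Real.log n ^ (3 * (d : ℝ) / 2 - 1) :=
    Real.rpow_le_rpow hl2.le hlog2 (by linarith)
  have h2 : 1 ≤ Real.exp (M * (4 * q * d * Real.log n) ^ (k / 2)) :=
    Real.one_le_exp (by positivity)
  have h3 : 0 < Real.log 2 ^ (3 * (d : ℝ) / 2 - 1) := by positivity
  rw [inv_mul_eq_div, le_div_iff₀ h3, thetaRate, mul_assoc]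
  gcongr
  nlinarith

/-- The error bound for one fixed integrand: the projected part of the sample contributes the rate,
the remainder is controlled in `L^q`. -/
theorem exists_growthClass_bounds {d : ℕ} (hd : 1 ≤ d) {M B k q : ℝ} (C : ℝ)
    (hM : 0 < M) (hB : 0 < B) (hk : 0 < k) (hk2 : k < 2) (hq : 1 ≤ q) :
    ∃ K : ℝ, 0 < K ∧ ∀ G : RSp d → ℝ, Measurable G → G ∘ stdNormalCDF ∈ GrowthClass d M B k →
      Integrable G (uniformCube d) ∧ ∀ n : ℕ, 2 ≤ n →
      eLpNorm (fun w => G w - G (clampCube (2 * √(q * Real.log n)) w)) (ENNReal.ofReal q)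
        (uniformCube d) ≤ ENNReal.ofReal (K * thetaRate d M k q n) ∧
      ∀ u : Fin n → RSp d, (∀ i j, 0 < u i j ∧ u i j < 1) →
      starDiscrepancy u ≤ C * Real.log n ^ (d - 1) / n →
      |(n : ℝ)⁻¹ * ∑ i, G (u i) - ∫ w, G w ∂(uniformCube d)|
        ≤ (n : ℝ)⁻¹ * ∑ i, |G (u i) - G (clampCube (2 * √(q * Real.log n)) (u i))|
          + K * thetaRate d M k q n := by
  have hq0 : 0 < q := by linarith
  obtain ⟨K₁, hK₁, h₁⟩ := exists_abs_average_clampCube_sub_le hd C hM hB hk hq0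
  obtain ⟨K₂, hK₂, h₂⟩ := exists_eLpNorm_sub_clampBox_le d hM hB hk hk2 hq0
  set L := (Real.log 2 ^ (3 * (d : ℝ) / 2 - 1))⁻¹
  have hL : 0 < L := by
    have hl2 : 0 < Real.log 2 := Real.log_pos one_lt_two
    positivity
  refine ⟨K₁ + K₂ * L, by positivity, fun G hG hGr => ?_⟩
  obtain ⟨g, hg, hgb⟩ := hGr
  have hfb : ∀ x, |(G ∘ stdNormalCDF) x| ≤ B * Real.exp (M * ‖x‖ ^ k) := fun x => by
    have := hgb ∅ x; rwa [hg.1] at this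
  have hfc : Continuous (G ∘ stdNormalCDF) := by
    have := hg.2.1 ∅; rwa [hg.1] at this
  have hint : Integrable G (uniformCube d) := by
    rw [← map_stdNormalCDF, integrable_map_measure hG.aestronglyMeasurable
      continuous_stdNormalCDF.aemeasurable]
    have hE := (memLp_exp_norm_rpow (d := d) (p := 1) hM hk hk2 one_pos)
    rw [ENNReal.ofReal_one, memLp_one_iff_integrable] at hE
    exact (hE.const_mul B).mono' hfc.aestronglyMeasurable (Filter.Eventually.of_forall hfb)
  refine ⟨hint, fun n hn => ?_⟩
  set R := 2 * √(q * Real.log n) with hRdef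
  have hGc : Measurable fun w => G (clampCube R w) := hG.comp (measurable_clampCube R)
  have hGd : Measurable fun w => G w - G (clampCube R w) := hG.sub hGc
  have hrate : 0 ≤ thetaRate d M k q n := by unfold thetaRate; positivity
  have hle : K₂ / n ≤ K₂ * L * thetaRate d M k q n := by
    rw [div_eq_mul_inv, mul_assoc]
    gcongr
    exact inv_le_thetaRate hd hM hq0 hn
  have htail : eLpNorm (fun w => G w - G (clampCube R w)) (ENNReal.ofReal q) (uniformCube d)
      ≤ ENNReal.ofReal (K₂ * L * thetaRate d M k q n) := by
    rw [← map_stdNormalCDF, eLpNorm_map_measure hGd.aestronglyMeasurable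
      continuous_stdNormalCDF.aemeasurable]
    refine le_trans (le_of_eq ?_) ((h₂ (G ∘ stdNormalCDF) hfb n (by omega)).trans
      (ENNReal.ofReal_le_ofReal hle))
    congr 1
    ext x
    simp only [Function.comp_apply, clampCube_stdNormalCDF, hRdef]
  refine ⟨htail.trans (ENNReal.ofReal_le_ofReal ?_), fun u hu hdisc => ?_⟩
  · rw [add_mul]; linarith [mul_nonneg hK₁.le hrate]
  have h3 := h₁ G hG ⟨g, hg, hgb⟩ n hn u hu hdisc
  -- The bias caused by the projection is an `L^1` norm, bounded by the `L^q` norm on a probability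
  -- space.
  have h4 : eLpNorm (fun w => G w - G (clampCube R w)) 1 (uniformCube d)
      ≤ ENNReal.ofReal (K₂ * L * thetaRate d M k q n) :=
    (eLpNorm_le_eLpNorm_of_exponent_le (by simpa using hq)
      hGd.aestronglyMeasurable).trans htail
  have hdint : Integrable (fun w => G w - G (clampCube R w)) (uniformCube d) :=
    memLp_one_iff_integrable.1 ⟨hGd.aestronglyMeasurable, h4.trans_lt ENNReal.ofReal_lt_top⟩
  have hcint : Integrable (fun w => G (clampCube R w)) (uniformCube d) := by
    refine (hint.sub hdint).congr (Filter.Eventually.of_forall fun w => ?_)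
    simp
  have h5 : |∫ w, G w ∂(uniformCube d) - ∫ w, G (clampCube R w) ∂(uniformCube d)|
      ≤ K₂ * L * thetaRate d M k q n := by
    rw [← integral_sub hint hcint, ← Real.norm_eq_abs]
    have h6 := enorm_integral_le_lintegral_enorm (μ := uniformCube d)
      fun w => G w - G (clampCube R w)
    rw [← eLpNorm_one_eq_lintegral_enorm, ← ofReal_norm] at h6
    exact (ENNReal.ofReal_le_ofReal_iff (by positivity)).1 (h6.trans h4)
  have h7 : |(n : ℝ)⁻¹ * ∑ i, G (u i) - (n : ℝ)⁻¹ * ∑ i, G (clampCube R (u i))| ≤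
      (n : ℝ)⁻¹ * ∑ i, |G (u i) - G (clampCube R (u i))| := by
    rw [← mul_sub, ← Finset.sum_sub_distrib, abs_mul, abs_of_nonneg (by positivity)]
    gcongr
    exact Finset.abs_sum_le_sum_abs _ _
  rw [abs_le] at h3 h5 h7 ⊢
  rw [add_mul]
  constructor <;> linarith

/-! ### Integrands with an independent random parameter -/

lemma eLpNorm_prod_le_of_ae_le {α β : Type*} [MeasurableSpace α] [MeasurableSpace β]
    {μ : Measure α} {ν : Measure β} [IsProbabilityMeasure μ] [SFinite ν] {f : α × β → ℝ}
    (hf : Measurable f) {p c : ENNReal} (hp : p ≠ 0) (hp' : p ≠ ⊤)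
    (h : ∀ᵐ a ∂μ, eLpNorm (fun b => f (a, b)) p ν ≤ c) : eLpNorm f p (μ.prod ν) ≤ c := by
  have hp0 : 0 < p.toReal := ENNReal.toReal_pos hp hp'
  rw [eLpNorm_eq_lintegral_rpow_enorm_toReal hp hp', one_div, ENNReal.rpow_inv_le_iff hp0,
    lintegral_prod _ (by fun_prop)]
  refine (lintegral_mono_ae (g := fun _ => c ^ p.toReal) ?_).trans (by simp)
  filter_upwards [h] with a ha
  rwa [eLpNorm_eq_lintegral_rpow_enorm_toReal hp hp', one_div, ENNReal.rpow_inv_le_iff hp0] at ha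

/-- Independence makes the joint law a product, so a bound for almost every frozen parameter
survives averaging over it by Tonelli. -/
lemma eLpNorm_comp_prodMk_le {Ω α β : Type*} [MeasurableSpace Ω] [MeasurableSpace α]
    [MeasurableSpace β] {P : Measure Ω} [IsProbabilityMeasure P] {θ : Ω → α} {u : Ω → β}
    (hθ : Measurable θ) (hu : Measurable u) (hind : IndepFun u θ P) {f : α × β → ℝ}
    (hf : Measurable f) {p c : ENNReal} (hp : p ≠ 0) (hp' : p ≠ ⊤)
    (h : ∀ᵐ ω ∂P, eLpNorm (fun b => f (θ ω, b)) p (P.map u) ≤ c) :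
    eLpNorm (fun ω => f (θ ω, u ω)) p P ≤ c := by
  have hpair : P.map (fun ω => (θ ω, u ω)) = (P.map θ).prod (P.map u) :=
    (indepFun_iff_map_prod_eq_prod_map_map hθ.aemeasurable hu.aemeasurable).1 hind.symm
  have hu' : IsProbabilityMeasure (P.map u) := Measure.isProbabilityMeasure_map hu.aemeasurable
  have hθ' : IsProbabilityMeasure (P.map θ) := Measure.isProbabilityMeasure_map hθ.aemeasurable
  have h1 : eLpNorm (fun ω => f (θ ω, u ω)) p P = eLpNorm f p (P.map fun ω => (θ ω, u ω)) :=
    (eLpNorm_map_measure hf.aestronglyMeasurable (hθ.prodMk hu).aemeasurable).symm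
  rw [h1, hpair]
  refine eLpNorm_prod_le_of_ae_le hf hp hp' ?_
  have hm : Measurable fun a => eLpNorm (fun b => f (a, b)) p (P.map u) := by
    simp only [eLpNorm_eq_lintegral_rpow_enorm_toReal hp hp']
    refine Measurable.pow_const ?_ _
    exact Measurable.lintegral_prod_right' (f := fun z => ‖f z‖ₑ ^ p.toReal) (by fun_prop)
  rw [ae_map_iff hθ.aemeasurable (measurableSet_le hm measurable_const)]
  exact h

/-- `L^q` error of an RQMC average of integrands with an independent random parameter. -/
theorem exists_eLpNorm_average_sub_le {d : ℕ} (hd : 1 ≤ d) {M B k q : ℝ} (C : ℝ)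
    (hM : 0 < M) (hB : 0 < B) (hk : 0 < k) (hk2 : k < 2) (hq : 1 ≤ q) :
    ∃ K : ℝ, 0 < K ∧
      (∀ G : RSp d → ℝ, Measurable G → G ∘ stdNormalCDF ∈ GrowthClass d M B k →
        Integrable G (uniformCube d)) ∧
      ∀ {Ω α : Type*} [MeasurableSpace Ω] [MeasurableSpace α] (P : Measure Ω)
        [IsProbabilityMeasure P] (Θ : Set α) (G : α → RSp d → ℝ) (c : ℝ)
        (n : ℕ) (θ : Ω → α) (u : Fin n → Ω → RSp d),
        (Measurable fun p : α × RSp d => G p.1 p.2) →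
        (∀ a ∈ Θ, G a ∘ stdNormalCDF ∈ GrowthClass d M B k) →
        (∀ a ∈ Θ, ∫ w, G a w ∂(uniformCube d) = c) →
        2 ≤ n → Measurable θ → (∀ᵐ ω ∂P, θ ω ∈ Θ) → IsRQMC P C u →
        IndepFun (fun ω i => u i ω) θ P →
        eLpNorm (fun ω => (n : ℝ)⁻¹ * ∑ i, G (θ ω) (u i ω) - c) (ENNReal.ofReal q) P
          ≤ ENNReal.ofReal (K * thetaRate d M k q n) := by
  obtain ⟨K, hK, h⟩ := exists_growthClass_bounds hd C hM hB hk hk2 hq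
  -- One `K` for the averaged remainders, one for the pathwise bound.
  refine ⟨2 * K, by positivity, fun G hG hGr => (h G hG hGr).1, ?_⟩
  intro Ω α _ _ P _ Θ G c n θ u hGm hGr hGc hn hθ hΘ hu hind
  set R := 2 * √(q * Real.log n)
  have hn0 : (0 : ℝ) < n := by positivity
  have hrate : 0 ≤ K * thetaRate d M k q n := by
    have := Real.log_natCast_nonneg n
    unfold thetaRate; positivity
  set H : α × RSp d → ℝ := fun p => |G p.1 p.2 - G p.1 (clampCube R p.2)| with hH
  have hHm : Measurable H := by
    have h1 : Measurable fun p : α × RSp d => G p.1 (clampCube R p.2) :=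
      hGm.comp (measurable_fst.prodMk ((measurable_clampCube R).comp measurable_snd))
    exact (hGm.sub h1).norm
  have hGa : ∀ a, Measurable (G a) := fun a => hGm.of_uncurry_left
  -- Only the uniform law of the single point and its independence of the parameter enter here.
  have hpoint : ∀ i, eLpNorm (fun ω => H (θ ω, u i ω)) (ENNReal.ofReal q) P
      ≤ ENNReal.ofReal (K * thetaRate d M k q n) := by
    intro i
    have hind' : IndepFun (u i) θ P := hind.comp (measurable_pi_apply i) measurable_id
    refine eLpNorm_comp_prodMk_le hθ (hu.measurable i) hind' hHm (by simp; linarith)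
      ENNReal.ofReal_ne_top ?_
    rw [hu.uniform i]
    filter_upwards [hΘ] with ω hω
    have h2 := (((h (G (θ ω)) (hGa _) (hGr _ hω)).2 n hn).1)
    rwa [← eLpNorm_norm] at h2
  have hmem : ∀ᵐ ω ∂P, ∀ i j, 0 < u i ω j ∧ u i ω j < 1 := by
    rw [ae_all_iff]
    intro i
    have := ae_uniformCube_mem_Ioo d
    rw [← hu.uniform i] at this
    exact ae_of_ae_map (hu.measurable i).aemeasurable this
  have hHi : ∀ i, Measurable fun ω => H (θ ω, u i ω) := fun i =>
    hHm.comp (hθ.prodMk (hu.measurable i))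
  have hq1 : 1 ≤ ENNReal.ofReal q := by simpa using hq
  have hS : eLpNorm (fun ω => (n : ℝ)⁻¹ * ∑ i, H (θ ω, u i ω)) (ENNReal.ofReal q) P
      ≤ ENNReal.ofReal (K * thetaRate d M k q n) := by
    have h3 : (fun ω => (n : ℝ)⁻¹ * ∑ i, H (θ ω, u i ω)) =
        (n : ℝ)⁻¹ • ∑ i, fun ω => H (θ ω, u i ω) := by
      ext ω; simp
    rw [h3, eLpNorm_const_smul]
    calc _ ≤ ‖(n : ℝ)⁻¹‖ₑ * ∑ _i : Fin n, ENNReal.ofReal (K * thetaRate d M k q n) := by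
          gcongr
          exact (eLpNorm_sum_le (fun i _ => (hHi i).aestronglyMeasurable) hq1).trans
            (Finset.sum_le_sum fun i _ => hpoint i)
      _ = _ := by
          rw [Finset.sum_const, Finset.card_univ, Fintype.card_fin, nsmul_eq_mul, ← mul_assoc,
            Real.enorm_of_nonneg (by positivity), ← ENNReal.ofReal_natCast,
            ← ENNReal.ofReal_mul (by positivity), inv_mul_cancel₀ hn0.ne', ENNReal.ofReal_one,
            one_mul]
  have hbound : ∀ᵐ ω ∂P, ‖(n : ℝ)⁻¹ * ∑ i, G (θ ω) (u i ω) - c‖ ≤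
      ‖((fun ω => (n : ℝ)⁻¹ * ∑ i, H (θ ω, u i ω)) + fun _ : Ω => K * thetaRate d M k q n : Ω → ℝ) ω‖ := by
    filter_upwards [hΘ, hmem, hu.discrepancy] with ω h1 h2 h3
    have h4 := ((h (G (θ ω)) (hGa _) (hGr _ h1)).2 n hn).2 (fun i => u i ω) h2 h3
    rw [hGc _ h1] at h4
    exact h4.trans (le_abs_self _)
  refine (eLpNorm_mono_ae hbound).trans ((eLpNorm_add_le
    ((Finset.measurable_sum _ fun i _ => hHi i).const_mul _).aestronglyMeasurable
    aestronglyMeasurable_const hq1).trans ?_)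
  have hc : eLpNorm (fun _ : Ω => K * thetaRate d M k q n) (ENNReal.ofReal q) P ≤
      ENNReal.ofReal (K * thetaRate d M k q n) := by
    refine (eLpNorm_le_of_ae_bound (C := K * thetaRate d M k q n)
      (Filter.Eventually.of_forall fun _ => ?_)).trans (by simp)
    rw [Real.norm_of_nonneg hrate]
  refine (add_le_add hS hc).trans ?_
  rw [← ENNReal.ofReal_add hrate hrate]
  exact ENNReal.ofReal_le_ofReal (by linarith)

/-! ### Measurability and unbiasedness of the weighted estimator -/

namespace MAMIS

variable {d s D : ℕ} {Ω : Type*} {A : MAMIS d s D Ω}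

/-- The `j`-th coordinate of the weighted integrand as a function on the unit cube. -/
noncomputable def cubeIntegrand (A : MAMIS d s D Ω) (j : Fin D) (θ : RSp D) (u : RSp d) : ℝ :=
  A.weighted θ (A.F θ u) j

lemma cubeIntegrand_eq (A : MAMIS d s D Ω) (j : Fin D) (θ : RSp D) (u : RSp d) :
    A.cubeIntegrand j θ u = A.target (A.F θ u) * A.h (A.F θ u) j / A.q (A.F θ u) θ := by
  simp [cubeIntegrand, weighted, div_mul_eq_mul_div]

lemma thetaHat_succ_apply (A : MAMIS d s D Ω) {t : ℕ} (ht : 1 ≤ t) (ω : Ω) (j : Fin D) :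
    A.thetaHat (t + 1) ω j = (A.N t : ℝ)⁻¹ * ∑ i, A.cubeIntegrand j (A.thetaHat t ω) (A.u t i ω) := by
  obtain ⟨t, rfl⟩ := Nat.exists_eq_add_of_le' ht
  simp [thetaHat, cubeIntegrand]

lemma thetaStar_apply (A : MAMIS d s D Ω)
    (h : ∀ j, Integrable (fun x => A.target x * A.h x j) (volume.restrict A.X)) (j : Fin D) :
    A.thetaStar j = ∫ x in A.X, A.target x * A.h x j :=
  eval_integral_piLp (f := fun x => A.target x • A.h x) h j

variable [MeasurableSpace Ω] {P : Measure Ω} {C : ℝ}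

lemma Standing.measurable_weighted (hA : A.Standing P C) :
    Measurable fun p : RSp D × RSp d => A.weighted p.1 (A.F p.1 p.2) := by
  have hF := hA.measurable_F
  have h1 := hA.measurable_target.comp hF
  have h2 := hA.measurable_h.comp hF
  have h3 := hA.measurable_q.comp (hF.prodMk measurable_fst)
  exact (h1.div h3).smul h2

lemma Standing.measurable_cubeIntegrand (hA : A.Standing P C) (j : Fin D) :
    Measurable fun p : RSp D × RSp d => A.cubeIntegrand j p.1 p.2 := by
  have h : Measurable fun x : RSp D => x j := by fun_prop
  exact h.comp hA.measurable_weighted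

lemma Standing.measurable_thetaHat (hA : A.Standing P C) :
    ∀ t, t ≤ A.T + 1 → Measurable (A.thetaHat t)
  | 0, _ => measurable_const
  | 1, _ => measurable_const
  | t + 2, ht => by
    have ih := hA.measurable_thetaHat (t + 1) (by omega)
    have hu := (hA.rqmc (t + 1) (Finset.mem_Icc.2 ⟨by omega, by omega⟩)).measurable
    simp only [thetaHat]
    refine Measurable.const_smul (M := ℝ) (Finset.measurable_fun_sum _ fun i _ => ?_) _
    exact hA.measurable_weighted.comp (ih.prodMk (hu i))

/-- The zero set of `q(·, θ)` is `Q(θ)`-null, hence `Π`-null. Thus the convention `a / 0 = 0` in the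
weights loses no mass. -/
lemma Standing.target_eq_zero (hA : A.Standing P C) {θ : RSp D} (hθ : θ ∈ A.Θ) :
    ∀ᵐ x ∂(volume.restrict A.X), A.q x θ = 0 → A.target x = 0 := by
  have hqm : Measurable fun x => A.q x θ := hA.measurable_q.of_uncurry_right
  have hS : MeasurableSet {x | A.q x θ = 0} := hqm (measurableSet_singleton 0)
  have h1 : A.proposal θ {x | A.q x θ = 0} = 0 := by
    rw [proposal, withDensity_apply _ hS]
    refine (setLIntegral_congr_fun hS (g := fun _ => 0) fun x hx => ?_).trans (by simp)
    simp [show A.q x θ = 0 from hx]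
  have h2 := hA.dominated θ hθ h1
  rw [targetMeasure, withDensity_apply_eq_zero' (by have := hA.measurable_target; fun_prop)] at h2
  have h3 : ∀ᵐ x ∂(volume.restrict A.X),
      ¬ (ENNReal.ofReal (A.target x) ≠ 0 ∧ A.q x θ = 0) := by
    rw [ae_iff]; simp only [not_not]; exact h2
  filter_upwards [h3, ae_restrict_mem hA.measurableSet_X] with x hx hxX hq
  by_contra h0
  refine hx ⟨?_, hq⟩
  have := lt_of_le_of_ne (hA.target_nonneg x hxX) (Ne.symm h0)
  simpa using this

/-- Importance sampling: under `Q(θ)` the density `q` cancels the denominator, so the mean is the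
same for all `θ ∈ Θ`. Integrability of `π h_j` is a consequence of that of the pulled-back
integrand, not an assumption. -/
lemma Standing.integrable_and_integral_cubeIntegrand (hA : A.Standing P C) {θ : RSp D}
    (hθ : θ ∈ A.Θ) (j : Fin D) (hint : Integrable (A.cubeIntegrand j θ) (uniformCube d)) :
    Integrable (fun x => A.target x * A.h x j) (volume.restrict A.X) ∧
      ∫ u, A.cubeIntegrand j θ u ∂(uniformCube d) = ∫ x in A.X, A.target x * A.h x j := by
  have hF : Measurable (A.F θ) := hA.measurable_F.of_uncurry_left
  have hqm : Measurable fun x => A.q x θ := hA.measurable_q.of_uncurry_right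
  have hw : Measurable fun x => A.target x * A.h x j / A.q x θ := by
    have := hA.measurable_target
    have := hA.measurable_h
    fun_prop
  have heq : A.cubeIntegrand j θ = (fun x => A.target x * A.h x j / A.q x θ) ∘ A.F θ :=
    funext fun u => A.cubeIntegrand_eq j θ u
  have hdens : AEMeasurable (fun x => ENNReal.ofReal (A.q x θ)) (volume.restrict A.X) := by fun_prop
  have hcongr : (fun x => (ENNReal.ofReal (A.q x θ)).toReal • (A.target x * A.h x j / A.q x θ))
      =ᵐ[volume.restrict A.X] fun x => A.target x * A.h x j := by
    filter_upwards [hA.target_eq_zero hθ, ae_restrict_mem hA.measurableSet_X] with x hx hxX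
    rw [ENNReal.toReal_ofReal (hA.q_nonneg θ hθ x hxX), smul_eq_mul]
    by_cases h0 : A.q x θ = 0
    · simp [h0, hx h0]
    · field_simp
  have hfin : ∀ᵐ x ∂(volume.restrict A.X), ENNReal.ofReal (A.q x θ) < ⊤ :=
    Filter.Eventually.of_forall fun _ => ENNReal.ofReal_lt_top
  rw [heq] at hint ⊢
  rw [← integrable_map_measure hw.aestronglyMeasurable hF.aemeasurable, hA.generator θ hθ,
    proposal, integrable_withDensity_iff_integrable_smul₀' hdens hfin] at hint
  refine ⟨hint.congr hcongr, ?_⟩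
  simp only [Function.comp_apply]
  rw [← integral_map hF.aemeasurable hw.aestronglyMeasurable, hA.generator θ hθ, proposal,
    integral_withDensity_eq_integral_toReal_smul₀ hdens hfin]
  exact integral_congr_ae hcongr

end MAMIS

/-! ### Convergence of the parameters -/

theorem MAMIS.exists_eLpNorm_thetaHat_apply_sub_le {d : ℕ} (hd : 1 ≤ d) {M B k q : ℝ} (C : ℝ)
    (hM : 0 < M) (hB : 0 < B) (hk : 0 < k) (hk2 : k < 2) (hq : 1 ≤ q) :
    ∃ K : ℝ, 0 < K ∧
      ∀ (s D : ℕ) (Ω : Type*) [MeasurableSpace Ω] (P : Measure Ω) [IsProbabilityMeasure P]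
        (A : MAMIS d s D Ω), A.Standing P C → A.Growth M B k →
        ∀ t ∈ Finset.Icc 1 A.T, 2 ≤ A.N t → ∀ j : Fin D,
          eLpNorm (fun ω => A.thetaHat (t + 1) ω j - A.thetaStar j) (ENNReal.ofReal q) P
            ≤ ENNReal.ofReal (K * thetaRate d M k q (A.N t)) := by
  obtain ⟨K, hK, hint, h⟩ := exists_eLpNorm_average_sub_le hd C hM hB hk hk2 hq
  refine ⟨K, hK, fun s D Ω _ P _ A hA hG t ht hn j => ?_⟩
  have ht' := Finset.mem_Icc.1 ht
  have hgrowth : ∀ j, ∀ θ ∈ A.Θ, A.cubeIntegrand j θ ∘ stdNormalCDF ∈ GrowthClass d M B k := by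
    intro j θ hθ
    convert hG θ hθ j using 1
    ext x
    simp [MAMIS.transport, MAMIS.cubeIntegrand_eq]
  have hcube : ∀ j, ∀ θ ∈ A.Θ, _ := fun j θ hθ =>
    hA.integrable_and_integral_cubeIntegrand hθ j (hint _
      (hA.measurable_cubeIntegrand j).of_uncurry_left (hgrowth j θ hθ))
  -- Some point of `Θ` is needed to get integrability of every `π h_j`, which lets the vector
  -- integral `θ*` be read coordinatewise.
  obtain ⟨ω₀, hω₀⟩ := (hA.mem_Θ t ht).exists
  have hstar := A.thetaStar_apply fun j => (hcube j _ hω₀).1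
  simp only [A.thetaHat_succ_apply ht'.1]
  refine h P A.Θ (A.cubeIntegrand j) (A.thetaStar j) (A.N t) (A.thetaHat t) (A.u t)
    (hA.measurable_cubeIntegrand j) (hgrowth j) (fun θ hθ => ?_) hn
    (hA.measurable_thetaHat t (by omega)) (hA.mem_Θ t ht) (hA.rqmc t ht) (hA.indep t ht)
  rw [(hcube j θ hθ).2, hstar j]

theorem mainTheorem4 (d : ℕ) (hd : 1 ≤ d) (M B k q C : ℝ) (hM : 0 < M) (hB : 0 < B)
    (hk : 0 < k) (hk2 : k < 2) (hq : 2 ≤ q) :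
    (∃ K : ℝ, 0 < K ∧
      ∀ (s D : ℕ) (Ω : Type*) [MeasurableSpace Ω] (P : Measure Ω) [IsProbabilityMeasure P]
        (A : MAMIS d s D Ω), A.Standing P C → A.Growth M B k →
        ∀ t ∈ Finset.Icc 1 A.T, 2 ≤ A.N t → ∀ j : Fin D,
          eLpNorm (fun ω => A.thetaHat (t + 1) ω j - A.thetaStar j) (ENNReal.ofReal q) P
            ≤ ENNReal.ofReal (K * thetaRate d M k q (A.N t))) ∧
    (∀ D : ℕ, ∃ K : ℝ, 0 < K ∧
      ∀ (s : ℕ) (Ω : Type*) [MeasurableSpace Ω] (P : Measure Ω) [IsProbabilityMeasure P]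
        (A : MAMIS d s D Ω), A.Standing P C → A.Growth M B k →
        ∀ t ∈ Finset.Icc 1 A.T, 2 ≤ A.N t →
          eLpNorm (fun ω => A.thetaHat (t + 1) ω - A.thetaStar) (ENNReal.ofReal q) P
            ≤ ENNReal.ofReal (K * thetaRate d M k q (A.N t))) := by
  refine ⟨MAMIS.exists_eLpNorm_thetaHat_apply_sub_le hd C hM hB hk hk2 (by linarith),
    fun D => ?_⟩
  obtain ⟨K, hK, h⟩ :=
    MAMIS.exists_eLpNorm_thetaHat_apply_sub_le hd C hM hB hk hk2 (by linarith : 1 ≤ q)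
  -- The Euclidean norm is at most the sum of the `D` coordinate errors; `D + 1` in place of `D`
  -- keeps the constant positive for `D = 0`.
  refine ⟨(D + 1) * K, by positivity, fun s Ω _ P _ A hA hG t ht hn => ?_⟩
  have ht' := Finset.mem_Icc.1 ht
  have hrate : 0 ≤ K * thetaRate d M k q (A.N t) := by
    have := Real.log_natCast_nonneg (A.N t)
    unfold thetaRate; positivity
  have hmeas : ∀ j, AEStronglyMeasurable
      (fun ω => ‖A.thetaHat (t + 1) ω j - A.thetaStar j‖) P := by
    intro j
    have h1 := hA.measurable_thetaHat (t + 1) (by omega)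
    have h2 : Measurable fun ω => A.thetaHat (t + 1) ω j := by fun_prop
    exact (h2.sub_const _).norm.aestronglyMeasurable
  have hnorm : ∀ v : RSp D, ‖v‖ ≤ ∑ j, ‖v j‖ := by
    intro v
    rw [EuclideanSpace.norm_eq]
    refine Real.sqrt_le_iff.2 ⟨by positivity, ?_⟩
    exact Finset.sum_sq_le_sq_sum_of_nonneg fun j _ => norm_nonneg _
  have hbound : ∀ ω, ‖A.thetaHat (t + 1) ω - A.thetaStar‖ ≤
      ‖(∑ j, fun ω => ‖A.thetaHat (t + 1) ω j - A.thetaStar j‖) ω‖ := by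
    intro ω
    refine (hnorm _).trans ?_
    rw [Finset.sum_apply]
    exact le_abs_self _
  refine (eLpNorm_mono hbound).trans ((eLpNorm_sum_le (fun j _ => hmeas j)
    (by simp; linarith)).trans ?_)
  calc _ ≤ ∑ _j : Fin D, ENNReal.ofReal (K * thetaRate d M k q (A.N t)) :=
        Finset.sum_le_sum fun j _ => by
          rw [eLpNorm_norm]; exact h s D Ω P A hA hG t ht hn j
    _ ≤ _ := by
        rw [Finset.sum_const, Finset.card_univ, Fintype.card_fin, nsmul_eq_mul,
          ← ENNReal.ofReal_natCast, ← ENNReal.ofReal_mul (by positivity), mul_assoc]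
        refine ENNReal.ofReal_le_ofReal ?_
        gcongr
        linarith
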